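/- Let $\mathcal A$ be a (not necessarily unital) $C^*$-algebra with positive cone $\mathcal A_+$ and the order $a\le b \iff b-a\in\mathcal A_+$. Let $\mathcal X$ be a set and let $k:\mathcal X\times\mathcal X\to\mathcal A$ be a positive definite kernel, i.e. $k(x,y)=k(y,x)^*$ and $\sum_{i,j=1}^n c_i^*k(x_i,x_j)c_j\in\mathcal A_+$ for all $n\in\mathbb N$, $c_i\in\mathcal A$, $x_i\in\mathcal X$. Put $\phi(x)=k(\cdot,x):\mathcal X\to\mathcal A$, and let $\mathcal M_{k,0}$ be the space of the functions $\sum_{i=1}^n\phi(x_i)c_i$ with the $\mathcal A$-valued inner product $$\Big\langle\sum_i\phi(x_i)c_i,\sum_j\phi(y_j)d_j\Big\rangle_k=\sum_{i,j}c_i^*k(x_i,y_j)d_j$$ and the norm $\|f\|_k=\|\langle f,f\rangle_k\|_{\mathcal A}^{1/2}$. Let the reproducing kernel Hilbert $\mathcal A$-module (RKHM) $\mathcal M_k$ be the completion of $\mathcal M_{k,0}$; the inner product and the evaluations $f\mapsto f(x)$ extend to $\mathcal M_k$ by continuity, and $|f|_k=\langle f,f\rangle_k^{1/2}\in\mathcal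 A_+$ for $f\in\mathcal M_k$. Let $x_1,\dots,x_N\in\mathcal X$, let $g:\mathcal A^N\to\mathcal A_+$ be continuous, and let $h:\mathcal A_+\to\mathcal A_+$ satisfy $h(c)\le h(d)$ whenever $c,d\in\mathcal A_+$ and $c\le d$. For $f\in\mathcal M_k$ let $$L(f)=g(f(x_1),\dots,f(x_N))+h(|f|_k).$$ If $f_0\in\mathcal M_k$ is a minimizer of $L$, i.e. $L(f_0)\le L(f)$ for all $f\in\mathcal M_k$, then for every $\epsilon>0$ there are $c_1,\dots,c_N\in\mathcal A$ such that $\tilde f=\sum_{i=1}^N\phi(x_i)c_i$ satisfies $\|L(\tilde f)-L(f_0)\|_{\mathcal A}\le\epsilon$. -/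

import Mathlib

noncomputable section

open scoped RightActions

/-- An `A`-valued positive definite kernel on a set `X`, for a C⋆-algebra `A`. -/
structure PDKernel (X A : Type*) [NonUnitalCStarAlgebra A] [PartialOrder A] where
  toFun : X → X → A
  star_symm : ∀ x y, toFun x y = star (toFun y x)
  nonneg : ∀ (n : ℕ) (x : Fin n → X) (c : Fin n → A),
    0 ≤ ∑ i, ∑ j, star (c i) * toFun (x i) (x j) * c j

namespace PDKernel

variable {X A : Type*} [NonUnitalCStarAlgebra A] [PartialOrder A]

/-- The feature map `φ(x) = k(·, x)`, with values in the functions `X → A`. Functions `X → A` are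
multiplied by elements of `A` on the right, pointwise: `(f <• c) y = f y * c`. -/
def feature (k : PDKernel X A) (x : X) : X → A := fun y => k.toFun y x

/-- The finite sum `∑ i, φ(x i) c i`, as a function `X → A`. -/
def comb (k : PDKernel X A) {n : ℕ} (x : Fin n → X) (c : Fin n → A) : X → A :=
  ∑ i, k.feature (x i) <• c i

lemma comb_apply (k : PDKernel X A) {n : ℕ} (x : Fin n → X) (c : Fin n → A) (y : X) :
    k.comb x c y = ∑ i, k.toFun y (x i) * c i := by
  simp [comb, feature]

/-- The space `M_{k,0}` of all finite sums `∑ i, φ(x i) c i`. -/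
def preSubmodule (k : PDKernel X A) : Submodule ℂ (X → A) where
  carrier := {f | ∃ (n : ℕ) (x : Fin n → X) (c : Fin n → A), f = k.comb x c}
  zero_mem' := ⟨0, Fin.elim0, Fin.elim0, by simp [comb]⟩
  add_mem' := by
    rintro _ _ ⟨n, x, c, rfl⟩ ⟨m, y, d, rfl⟩
    refine ⟨n + m, Fin.append x y, Fin.append c d, ?_⟩
    simp [comb, Fin.sum_univ_add]
  smul_mem' := by
    rintro z _ ⟨n, x, c, rfl⟩
    refine ⟨n, x, fun i => z • c i, ?_⟩
    ext y
    simp [comb_apply, Finset.smul_sum, mul_smul_comm]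

/-- `M_{k,0}` as a type of its own, so that it does not inherit the topology of `X → A`. -/
def Pre (k : PDKernel X A) : Type _ := k.preSubmodule

instance (k : PDKernel X A) : AddCommGroup k.Pre := inferInstanceAs (AddCommGroup k.preSubmodule)

instance (k : PDKernel X A) : Module ℂ k.Pre := inferInstanceAs (Module ℂ k.preSubmodule)

/-- Evaluation on `M_{k,0}`, whose elements are functions on `X`. -/
def preEval (k : PDKernel X A) (x : X) : k.Pre →ₗ[ℂ] A :=
  (LinearMap.proj x).comp k.preSubmodule.subtype

lemma pre_ext {k : PDKernel X A} {f g : k.Pre} (h : ∀ x, k.preEval x f = k.preEval x g) : f = g :=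
  Subtype.ext (funext h)

lemma pre_exists_rep {k : PDKernel X A} (f : k.Pre) :
    ∃ (n : ℕ) (x : Fin n → X) (c : Fin n → A), ∀ y, k.preEval y f = k.comb x c y := by
  obtain ⟨n, x, c, h⟩ := f.2
  exact ⟨n, x, c, fun y => congrFun h y⟩

/-- The right action of `A` on `M_{k,0}`. -/
instance (k : PDKernel X A) : SMul Aᵐᵒᵖ k.Pre where
  smul a f := ⟨f.1 <• a.unop, by
    obtain ⟨n, x, c, h⟩ := f.2
    refine ⟨n, x, fun i => c i * a.unop, ?_⟩
    ext y
    simp [h, comb_apply, Finset.sum_mul, mul_assoc]⟩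

@[simp]
lemma preEval_op_smul {k : PDKernel X A} (x : X) (a : A) (f : k.Pre) :
    k.preEval x (f <• a) = k.preEval x f * a := rfl

/-- The element `φ(x) c` of `M_{k,0}`. -/
def preFeatureMul (k : PDKernel X A) (x : X) (c : A) : k.Pre :=
  ⟨k.feature x <• c, 1, fun _ => x, fun _ => c, by simp [comb]⟩

@[simp]
lemma preEval_preFeatureMul (k : PDKernel X A) (x y : X) (c : A) :
    k.preEval y (k.preFeatureMul x c) = k.toFun y x * c := rfl

/-- The `A`-valued inner product on `M_{k,0}`: if `f = ∑ i, φ(x i) c i` and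
`g = ∑ j, φ(y j) d j`, it is `∑ i, (c i)⋆ g(x i) = ∑ i, ∑ j, (c i)⋆ k(x i, y j) d j`. It does not
depend on the representations chosen, see `preInner_eq` and `preInner_eq_sum`. -/
def preInner (k : PDKernel X A) (f g : k.Pre) : A :=
  ∑ i, star ((pre_exists_rep f).choose_spec.choose_spec.choose i) *
    k.preEval ((pre_exists_rep f).choose_spec.choose i) g

lemma star_preEval_sum {k : PDKernel X A} {f g : k.Pre} {n m : ℕ} {x : Fin n → X}
    {c : Fin n → A} {y : Fin m → X} {d : Fin m → A} (hf : ∀ z, k.preEval z f = k.comb x c z)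
    (hg : ∀ z, k.preEval z g = k.comb y d z) :
    ∑ i, star (c i) * k.preEval (x i) g = ∑ j, star (k.preEval (y j) f) * d j := by
  simp only [hf, hg, comb_apply, Finset.mul_sum, star_sum, star_mul, Finset.sum_mul]
  rw [Finset.sum_comm]
  refine Finset.sum_congr rfl fun j _ => Finset.sum_congr rfl fun i _ => ?_
  rw [← k.star_symm, mul_assoc]

lemma preInner_eq {k : PDKernel X A} {f : k.Pre} (g : k.Pre) {n : ℕ} {x : Fin n → X}
    {c : Fin n → A} (hf : ∀ z, k.preEval z f = k.comb x c z) :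
    k.preInner f g = ∑ i, star (c i) * k.preEval (x i) g := by
  obtain ⟨m, y, d, hg⟩ := pre_exists_rep g
  rw [preInner, star_preEval_sum (pre_exists_rep f).choose_spec.choose_spec.choose_spec hg,
    star_preEval_sum hf hg]

lemma preInner_eq_sum {k : PDKernel X A} {f g : k.Pre} {n m : ℕ} {x : Fin n → X}
    {c : Fin n → A} {y : Fin m → X} {d : Fin m → A} (hf : ∀ z, k.preEval z f = k.comb x c z)
    (hg : ∀ z, k.preEval z g = k.comb y d z) :
    k.preInner f g = ∑ i, ∑ j, star (c i) * k.toFun (x i) (y j) * d j := by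
  simp only [preInner_eq g hf, hg, comb_apply, Finset.mul_sum, mul_assoc]

/-- The reproducing property on `M_{k,0}`. -/
lemma preInner_preFeatureMul (k : PDKernel X A) (x : X) (c : A) (f : k.Pre) :
    k.preInner (k.preFeatureMul x c) f = star c * k.preEval x f := by
  rw [preInner_eq (n := 1) (x := fun _ => x) (c := fun _ => c) f
    (by intro z; simp [comb_apply])]
  simp

lemma preInner_add_right {k : PDKernel X A} (f g h : k.Pre) :
    k.preInner f (g + h) = k.preInner f g + k.preInner f h := by
  simp [preInner, mul_add, Finset.sum_add_distrib]

lemma preInner_smul_right {k : PDKernel X A} (z : ℂ) (f g : k.Pre) :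
    k.preInner f (z • g) = z • k.preInner f g := by
  simp [preInner, Finset.smul_sum, mul_smul_comm]

lemma preInner_op_smul_right {k : PDKernel X A} (a : A) (f g : k.Pre) :
    k.preInner f (g <• a) = k.preInner f g * a := by
  simp [preInner, Finset.sum_mul, mul_assoc]

lemma star_preInner {k : PDKernel X A} (f g : k.Pre) :
    star (k.preInner f g) = k.preInner g f := by
  obtain ⟨n, x, c, hf⟩ := pre_exists_rep f
  obtain ⟨m, y, d, hg⟩ := pre_exists_rep g
  rw [preInner_eq g hf, preInner_eq f hg, star_preEval_sum hf hg]
  simp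

lemma preInner_self_nonneg {k : PDKernel X A} (f : k.Pre) : 0 ≤ k.preInner f f := by
  obtain ⟨n, x, c, hf⟩ := pre_exists_rep f
  rw [preInner_eq_sum hf hf]
  exact k.nonneg n x c

lemma preInner_add_left {k : PDKernel X A} (f g h : k.Pre) :
    k.preInner (f + g) h = k.preInner f h + k.preInner g h := by
  rw [← star_preInner, preInner_add_right, star_add, star_preInner, star_preInner]

lemma preInner_op_smul_left {k : PDKernel X A} (a : A) (f g : k.Pre) :
    k.preInner (f <• a) g = star a * k.preInner f g := by
  rw [← star_preInner, preInner_op_smul_right, star_mul, star_preInner]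

lemma preInner_smul_left {k : PDKernel X A} (z : ℂ) (f g : k.Pre) :
    k.preInner (z • f) g = star z • k.preInner f g := by
  rw [← star_preInner, preInner_smul_right, star_smul, star_preInner]

/-- The norm `‖f‖ = ‖⟨f, f⟩‖ ^ (1/2)` on `M_{k,0}`. -/
instance (k : PDKernel X A) : Norm k.Pre where
  norm f := √‖k.preInner f f‖

lemma pre_norm_def {k : PDKernel X A} (f : k.Pre) : ‖f‖ = √‖k.preInner f f‖ := rfl

variable [StarOrderedRing A]

lemma preInner_eq_zero_of_self {k : PDKernel X A} {f : k.Pre} (hf : k.preInner f f = 0)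
    (g : k.Pre) : k.preInner f g = 0 := by
  set b := k.preInner f g with hb
  have key : ∀ t : ℝ, 0 < t → t * ‖star b * b‖ ≤ ‖k.preInner g g‖ := by
    intro t ht
    have h0 := preInner_self_nonneg (g + (-((t / 2 : ℝ) : ℂ)) • (f <• b))
    have hgf : k.preInner g f = star b := by rw [hb, star_preInner]
    simp only [preInner_add_left, preInner_add_right, preInner_smul_left, preInner_smul_right,
      preInner_op_smul_left, preInner_op_smul_right, hf, hgf, ← hb, mul_zero, smul_zero,
      add_zero] at h0
    have h1 : t • (star b * b) ≤ k.preInner g g := by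
      rw [← sub_nonneg]
      convert h0 using 1
      have : t • (star b * b) = ((t : ℝ) : ℂ) • (star b * b) := by simp
      rw [this]
      simp only [star_neg, Complex.star_def, Complex.conj_ofReal, add_assoc, ← add_smul,
        sub_eq_add_neg, ← neg_smul]
      congr 2
      push_cast
      ring
    have h2 : 0 ≤ t • (star b * b) := smul_nonneg ht.le (star_mul_self_nonneg b)
    have h3 := CStarAlgebra.norm_le_norm_of_nonneg_of_le h2 h1
    rwa [norm_smul, Real.norm_of_nonneg ht.le] at h3
  have hz : ‖star b * b‖ = 0 := by
    by_contra hne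
    have hpos : 0 < ‖star b * b‖ := lt_of_le_of_ne (norm_nonneg _) (Ne.symm hne)
    have h4 := key ((‖k.preInner g g‖ + 1) / ‖star b * b‖) (by positivity)
    rw [div_mul_cancel₀ _ hne] at h4
    linarith
  rwa [CStarRing.norm_star_mul_self, mul_self_eq_zero, norm_eq_zero] at hz

lemma preInner_self_eq_zero {k : PDKernel X A} {f : k.Pre} : k.preInner f f = 0 ↔ f = 0 := by
  refine ⟨fun hf => pre_ext fun x => ?_, ?_⟩
  · have h := preInner_eq_zero_of_self hf (k.preFeatureMul x (k.preEval x f))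
    rw [← star_preInner, preInner_preFeatureMul, star_eq_zero, ← norm_eq_zero,
      CStarRing.norm_star_mul_self, mul_self_eq_zero, norm_eq_zero] at h
    rw [h, map_zero]
  · rintro rfl
    simp [preInner]

/-- Right Hilbert modules over `A` are Mathlib's Hilbert C⋆-modules over the opposite algebra. -/
instance (k : PDKernel X A) : CStarModule Aᵐᵒᵖ k.Pre where
  inner f g := MulOpposite.op (k.preInner f g)
  inner_add_right := by intros; simp [preInner_add_right]
  inner_self_nonneg := by intro f; exact preInner_self_nonneg f
  inner_self := by intro f; simp [preInner_self_eq_zero]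
  inner_op_smul_right := by
    intro a f g
    exact congrArg MulOpposite.op (preInner_op_smul_right a.unop f g)
  inner_smul_right_complex := by intros; simp [preInner_smul_right]
  star_inner f g := by simp [← MulOpposite.op_star, star_preInner]
  norm_eq_sqrt_norm_inner_self f := rfl

instance (k : PDKernel X A) : NormedAddCommGroup k.Pre :=
  NormedAddCommGroup.ofCore (CStarModule.normedSpaceCore Aᵐᵒᵖ)

instance (k : PDKernel X A) : NormedSpace ℂ k.Pre :=
  NormedSpace.ofCore (CStarModule.normedSpaceCore Aᵐᵒᵖ)

lemma norm_preInner_le {k : PDKernel X A} (f g : k.Pre) : ‖k.preInner f g‖ ≤ ‖f‖ * ‖g‖ :=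
  CStarModule.norm_inner_le (A := Aᵐᵒᵖ) k.Pre (x := f) (y := g)

lemma continuous_preInner (k : PDKernel X A) :
    Continuous fun p : k.Pre × k.Pre => k.preInner p.1 p.2 :=
  MulOpposite.continuous_unop.comp (CStarModule.continuous_inner (A := Aᵐᵒᵖ) (E := k.Pre))

lemma norm_preEval_le (k : PDKernel X A) (x : X) (f : k.Pre) :
    ‖k.preEval x f‖ ≤ √‖k.toFun x x‖ * ‖f‖ := by
  rcases eq_or_ne (k.preEval x f) 0 with h0 | h0
  · rw [h0, norm_zero]; positivity
  set d := k.preEval x f with hd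
  have hpos : 0 < ‖d‖ := norm_pos_iff.mpr h0
  have h1 := norm_preInner_le (k.preFeatureMul x d) f
  rw [preInner_preFeatureMul, ← hd, CStarRing.norm_star_mul_self] at h1
  have h2 : ‖k.preFeatureMul x d‖ ≤ √‖k.toFun x x‖ * ‖d‖ := by
    rw [pre_norm_def, preInner_preFeatureMul, preEval_preFeatureMul]
    refine Real.sqrt_le_iff.mpr ⟨by positivity, ?_⟩
    rw [mul_pow, Real.sq_sqrt (norm_nonneg _)]
    calc ‖star d * (k.toFun x x * d)‖ ≤ ‖star d‖ * (‖k.toFun x x‖ * ‖d‖) :=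
          (norm_mul_le _ _).trans (by gcongr; exact norm_mul_le _ _)
      _ = ‖k.toFun x x‖ * ‖d‖ ^ 2 := by rw [norm_star]; ring
  have h3 : ‖d‖ * ‖d‖ ≤ ‖d‖ * (√‖k.toFun x x‖ * ‖f‖) := by
    calc _ ≤ _ := h1
      _ ≤ (√‖k.toFun x x‖ * ‖d‖) * ‖f‖ := by gcongr
      _ = _ := by ring
  exact le_of_mul_le_mul_left h3 hpos

/-- The reproducing kernel Hilbert module `M_k`: the completion of `M_{k,0}`. -/
abbrev RKHM (k : PDKernel X A) : Type _ := UniformSpace.Completion k.Pre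

/-- The value `f(x)` of an element `f` of `M_k`: the extension by continuity of the evaluation of
functions in `M_{k,0}`. -/
def eval (k : PDKernel X A) (x : X) : k.RKHM →L[ℂ] A :=
  ((k.preEval x).mkContinuous (√‖k.toFun x x‖) (k.norm_preEval_le x)).extend
    UniformSpace.Completion.toComplL

/-- The `A`-valued inner product on `M_k`: the extension by continuity of that of `M_{k,0}`. -/
def inner (k : PDKernel X A) (f g : k.RKHM) : A :=
  (UniformSpace.Completion.isDenseInducing_coe.prodMap
    UniformSpace.Completion.isDenseInducing_coe).extend
    (fun p : k.Pre × k.Pre => k.preInner p.1 p.2) (f, g)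

lemma eval_coe (k : PDKernel X A) (x : X) (f : k.Pre) :
    k.eval x (f : k.RKHM) = k.preEval x f :=
  ContinuousLinearMap.extend_eq _ UniformSpace.Completion.denseRange_coe
    (UniformSpace.Completion.isUniformInducing_coe _) f

lemma inner_coe (k : PDKernel X A) (f g : k.Pre) :
    k.inner (f : k.RKHM) (g : k.RKHM) = k.preInner f g :=
  (UniformSpace.Completion.isDenseInducing_coe.prodMap
    UniformSpace.Completion.isDenseInducing_coe).extend_eq k.continuous_preInner (f, g)

lemma continuous_inner (k : PDKernel X A) :
    Continuous fun p : k.RKHM × k.RKHM => k.inner p.1 p.2 := by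
  let B : k.Pre →+ k.Pre →+ A :=
    AddMonoidHom.mk' (fun f => AddMonoidHom.mk' (fun g => k.preInner f g) (preInner_add_right f))
      fun f g => by ext h; exact preInner_add_left f g h
  have hB : Continuous fun p : k.Pre × k.Pre => B p.1 p.2 := k.continuous_preInner
  have h : IsDenseInducing (UniformSpace.Completion.toCompl : k.Pre →+ k.RKHM) :=
    UniformSpace.Completion.isDenseInducing_coe
  have hE : Continuous ((h.prodMap h).extend fun p : k.Pre × k.Pre => B p.1 p.2) :=
    h.extend_Z_bilin h hB
  exact hE

/-- The `A`-valued absolute value `|f|_k = ⟨f, f⟩ ^ (1/2)`, an element of the positive cone. -/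
def absVal (k : PDKernel X A) (f : k.RKHM) : {a : A // 0 ≤ a} :=
  ⟨CFC.sqrt (k.inner f f), CFC.sqrt_nonneg _⟩

/-- The element `φ(x) c` of `M_k`. -/
def featureMul (k : PDKernel X A) (x : X) (c : A) : k.RKHM := (k.preFeatureMul x c : k.RKHM)

/-- The loss `L(f) = g(f(x₁), …, f(x_N)) + h(|f|_k)`. -/
def loss (k : PDKernel X A) {N : ℕ} (x : Fin N → X) (g : (Fin N → A) → {a : A // 0 ≤ a})
    (h : {a : A // 0 ≤ a} → {a : A // 0 ≤ a}) (f : k.RKHM) : A :=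
  (g fun i => k.eval (x i) f) + h (k.absVal f)

end PDKernel

end

/-! ### Moments of a symmetric positive contraction under a group-valued form. -/

section IteratedContraction

variable {E A : Type*} [AddCommGroup E] [AddCommGroup A]

/-! A Hilbert module need not project onto the span of the `φ(x i)`, so the projection of `f₀` is
replaced by Landweber iterates. Let `T` be evaluation at the points, `T⋆` the synthesis map and `B =
1 - τ T⋆T`, with `τ > 0` so small that `0 ≤ ⟨f, B f⟩ ≤ ⟨f, f⟩` in `A`. Then `f - B^n f` lies in the
range of `T⋆`.

The moments `s m = ⟨f, B^m f⟩` are nonnegative, decreasing and convex in the order of `A`. Hence `⟨f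
- B^n f, f - B^n f⟩ = s 0 - 2 s n + s (2n) ≤ s 0` (`form_sub_iterate_le`), and `τ ∑ |(B^n f)(x i)|²
= s (2n) - s (2n+1) ≤ s 0 / (2n)` (`nsmul_form_diff_le`), so `T (f - B^n f) → T f`
(`exists_seq_synthesis`).

For `f = f₀` the first bound must be exact, because `h` is monotone but perhaps not continuous. It
gives `0 ≤ L(f̃) - L(f₀) ≤ g(T f̃) - g(T f₀)`, and continuity of `g` finishes. -/

lemma form_iterate_iterate (ip : E →+ E →+ A) (B : E →+ E)
    (hadj : ∀ f g, ip (B f) g = ip f (B g)) (f : E) (i j : ℕ) :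
    ip (B^[i] f) (B^[j] f) = ip f (B^[i + j] f) := by
  induction i generalizing j with
  | zero => simp
  | succ i ih =>
    rw [Function.iterate_succ_apply', hadj, ← Function.iterate_succ_apply' B, ih,
      show i + j.succ = i + 1 + j by omega]

variable [PartialOrder A]

/-- Convexity of the moments: with `u = B^j f - B^(j+1) f`, the second difference is `⟨u, u⟩` for `m
= 2j` and `⟨u, B u⟩` for `m = 2j + 1`. -/
lemma form_second_diff_nonneg (ip : E →+ E →+ A) (B : E →+ E)
    (hadj : ∀ f g, ip (B f) g = ip f (B g)) (hpos : ∀ f, 0 ≤ ip f f)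
    (hB : ∀ f, 0 ≤ ip f (B f)) (f : E) (m : ℕ) :
    0 ≤ (ip f (B^[m] f) - ip f (B^[m + 1] f)) -
      (ip f (B^[m + 1] f) - ip f (B^[m + 2] f)) := by
  have key := form_iterate_iterate ip B hadj f
  obtain ⟨j, rfl | rfl⟩ := m.even_or_odd'
  · convert hpos (B^[j] f - B^[j + 1] f) using 1
    simp only [map_sub, AddMonoidHom.sub_apply, key]
    rw [show j + j = 2 * j by omega, show j + (j + 1) = 2 * j + 1 by omega,
      show j + 1 + j = 2 * j + 1 by omega, show j + 1 + (j + 1) = 2 * j + 2 by omega]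
  · convert hB (B^[j] f - B^[j + 1] f) using 1
    simp only [map_sub, AddMonoidHom.sub_apply, ← Function.iterate_succ_apply' B, key]
    rw [show j + j.succ = 2 * j + 1 by omega, show j + (j + 1).succ = 2 * j + 1 + 1 by omega,
      show j + 1 + j.succ = 2 * j + 1 + 1 by omega,
      show j + 1 + (j + 1).succ = 2 * j + 1 + 2 by omega]

lemma form_iterate_nonneg (ip : E →+ E →+ A) (B : E →+ E)
    (hadj : ∀ f g, ip (B f) g = ip f (B g)) (hpos : ∀ f, 0 ≤ ip f f)
    (hB : ∀ f, 0 ≤ ip f (B f)) (f : E) (m : ℕ) : 0 ≤ ip f (B^[m] f) := by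
  have key := form_iterate_iterate ip B hadj f
  obtain ⟨j, rfl | rfl⟩ := m.even_or_odd'
  · convert hpos (B^[j] f) using 1
    rw [key, two_mul]
  · convert hB (B^[j] f) using 1
    rw [← Function.iterate_succ_apply' B, key, show j + j.succ = 2 * j + 1 by omega]

variable [IsOrderedAddMonoid A]

lemma form_diff_nonneg (ip : E →+ E →+ A) (B : E →+ E)
    (hadj : ∀ f g, ip (B f) g = ip f (B g)) (hpos : ∀ f, 0 ≤ ip f f)
    (hB : ∀ f, 0 ≤ ip f (B f)) (hB' : ∀ f, ip f (B f) ≤ ip f f) (f : E) (m : ℕ) :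
    0 ≤ ip f (B^[m] f) - ip f (B^[m + 1] f) := by
  have key := form_iterate_iterate ip B hadj f
  have even : ∀ j, 0 ≤ ip f (B^[2 * j] f) - ip f (B^[2 * j + 1] f) := fun j => by
    convert sub_nonneg.2 (hB' (B^[j] f)) using 1
    rw [← Function.iterate_succ_apply' B, key, key, show j + j = 2 * j by omega,
      show j + j.succ = 2 * j + 1 by omega]
  obtain ⟨j, rfl | rfl⟩ := m.even_or_odd'
  · exact even j
  -- An odd difference dominates the next, even one by convexity.
  · exact (even (j + 1)).trans
      (sub_nonneg.1 (form_second_diff_nonneg ip B hadj hpos hB f (2 * j + 1)))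

lemma form_sub_iterate_le (ip : E →+ E →+ A) (B : E →+ E)
    (hadj : ∀ f g, ip (B f) g = ip f (B g)) (hpos : ∀ f, 0 ≤ ip f f)
    (hB : ∀ f, 0 ≤ ip f (B f)) (hB' : ∀ f, ip f (B f) ≤ ip f f) (f : E) (n : ℕ) :
    ip (f - B^[n] f) (f - B^[n] f) ≤ ip f f := by
  have key := form_iterate_iterate ip B hadj f
  have hanti : Antitone fun m => ip f (B^[m] f) := antitone_nat_of_succ_le fun m =>
    sub_nonneg.1 (form_diff_nonneg ip B hadj hpos hB hB' f m)
  have h1 : ip f (B^[n + n] f) ≤ ip f (B^[n] f) := hanti (by omega)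
  have h2 := form_iterate_nonneg ip B hadj hpos hB f n
  have h3 : ip (B^[n] f) f = ip f (B^[n] f) := key n 0
  rw [← sub_nonneg]
  convert add_nonneg (sub_nonneg.2 h1) h2 using 1
  simp only [map_sub, AddMonoidHom.sub_apply, key, h3]
  abel

/-- The differences of the moments decrease, so `n` copies of the `n`-th one are at most the
telescoping sum of the first `n`. This is the source of the `1/n` rate. -/
lemma nsmul_form_diff_le (ip : E →+ E →+ A) (B : E →+ E)
    (hadj : ∀ f g, ip (B f) g = ip f (B g)) (hpos : ∀ f, 0 ≤ ip f f)
    (hB : ∀ f, 0 ≤ ip f (B f)) (f : E) (n : ℕ) :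
    n • (ip f (B^[n] f) - ip f (B^[n + 1] f)) ≤ ip f f := by
  have h : n • (ip f (B^[n] f) - ip f (B^[n + 1] f)) ≤ ip f f - ip f (B^[n] f) := by
    induction n with
    | zero => simp
    | succ n ih =>
      have h2 := sub_nonneg.1 (form_second_diff_nonneg ip B hadj hpos hB f n)
      calc _ ≤ (n + 1) • (ip f (B^[n] f) - ip f (B^[n + 1] f)) := nsmul_le_nsmul_right h2 _
        _ ≤ (ip f f - ip f (B^[n] f)) + (ip f (B^[n] f) - ip f (B^[n + 1] f)) := by
          rw [succ_nsmul]; gcongr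
        _ = _ := by abel
  exact h.trans (sub_le_self _ (form_iterate_nonneg ip B hadj hpos hB f n))

end IteratedContraction

/-! ### The inner product and the reproducing property on the completion. -/

namespace PDKernel

variable {X A : Type*} [NonUnitalCStarAlgebra A] [PartialOrder A] [StarOrderedRing A]

lemma inner_add_right (k : PDKernel X A) (f g h : k.RKHM) :
    k.inner f (g + h) = k.inner f g + k.inner f h := by
  have hc := k.continuous_inner
  induction f, g, h using UniformSpace.Completion.induction_on₃ with
  | hp =>
    exact isClosed_eq
      (hc.comp (continuous_fst.prodMk (continuous_snd.fst.add continuous_snd.snd)))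
      ((hc.comp (continuous_fst.prodMk continuous_snd.fst)).add
        (hc.comp (continuous_fst.prodMk continuous_snd.snd)))
  | ih f g h => simp only [← UniformSpace.Completion.coe_add, inner_coe, preInner_add_right]

lemma star_inner (k : PDKernel X A) (f g : k.RKHM) : star (k.inner f g) = k.inner g f := by
  have hc := k.continuous_inner
  induction f, g using UniformSpace.Completion.induction_on₂ with
  | hp => exact isClosed_eq hc.star (hc.comp continuous_swap)
  | ih f g => simp only [inner_coe, star_preInner]

lemma inner_add_left (k : PDKernel X A) (f g h : k.RKHM) :
    k.inner (f + g) h = k.inner f h + k.inner g h := by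
  rw [← star_inner, inner_add_right, star_add, star_inner, star_inner]

lemma inner_self_nonneg (k : PDKernel X A) (f : k.RKHM) : 0 ≤ k.inner f f := by
  induction f using UniformSpace.Completion.induction_on with
  | hp =>
    exact (CStarAlgebra.isClosed_nonneg (A := A)).preimage
      (k.continuous_inner.comp (continuous_id.prodMk continuous_id))
  | ih f => simpa only [inner_coe] using preInner_self_nonneg f

lemma inner_smul_right (k : PDKernel X A) (z : ℂ) (f g : k.RKHM) :
    k.inner f (z • g) = z • k.inner f g := by
  have hc := k.continuous_inner
  induction f, g using UniformSpace.Completion.induction_on₂ with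
  | hp =>
    exact isClosed_eq (hc.comp (continuous_fst.prodMk (continuous_snd.const_smul z)))
      (hc.const_smul z)
  | ih f g => simp only [← UniformSpace.Completion.coe_smul, inner_coe, preInner_smul_right]

/-- The reproducing property on the completion. -/
lemma inner_featureMul (k : PDKernel X A) (x : X) (c : A) (f : k.RKHM) :
    k.inner (k.featureMul x c) f = star c * k.eval x f := by
  induction f using UniformSpace.Completion.induction_on with
  | hp =>
    exact isClosed_eq (k.continuous_inner.comp (continuous_const.prodMk continuous_id))
      (continuous_const.mul (k.eval x).continuous)
  | ih f => rw [featureMul, inner_coe, eval_coe, preInner_preFeatureMul]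

/-- The inner product of the module, as a biadditive map. -/
noncomputable def innerHom (k : PDKernel X A) : k.RKHM →+ k.RKHM →+ A :=
  AddMonoidHom.mk' (fun f => AddMonoidHom.mk' (fun g => k.inner f g) (k.inner_add_right f))
    fun f g => by ext h; exact k.inner_add_left f g h

@[simp]
lemma innerHom_apply (k : PDKernel X A) (f g : k.RKHM) : k.innerHom f g = k.inner f g := rfl

/-! ### Synthesis and evaluation as mutually adjoint maps. -/

lemma featureMul_add (k : PDKernel X A) (x : X) (c d : A) :
    k.featureMul x (c + d) = k.featureMul x c + k.featureMul x d := by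
  rw [featureMul, featureMul, featureMul, ← UniformSpace.Completion.coe_add]
  congr 1
  exact pre_ext fun y => by simp [mul_add]

lemma featureMul_smul (k : PDKernel X A) (x : X) (z : ℂ) (c : A) :
    k.featureMul x (z • c) = z • k.featureMul x c := by
  rw [featureMul, featureMul, ← UniformSpace.Completion.coe_smul]
  congr 1
  exact pre_ext fun y => by simp [mul_smul_comm]

/-- The map `c ↦ ∑ i, φ(x i) c i`, adjoint to the evaluation at the points `x i`. -/
noncomputable def synthesis (k : PDKernel X A) {N : ℕ} (x : Fin N → X) : (Fin N → A) →ₗ[ℂ] k.RKHM where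
  toFun c := ∑ i, k.featureMul (x i) (c i)
  map_add' c d := by simp [featureMul_add, Finset.sum_add_distrib]
  map_smul' z c := by simp [featureMul_smul, Finset.smul_sum]

/-- The evaluation at the points `x i`. -/
noncomputable def analysis (k : PDKernel X A) {N : ℕ} (x : Fin N → X) : k.RKHM →L[ℂ] (Fin N → A) :=
  ContinuousLinearMap.pi fun i => k.eval (x i)

lemma synthesis_apply (k : PDKernel X A) {N : ℕ} (x : Fin N → X) (c : Fin N → A) :
    k.synthesis x c = ∑ i, k.featureMul (x i) (c i) := rfl

@[simp]
lemma analysis_apply (k : PDKernel X A) {N : ℕ} (x : Fin N → X) (f : k.RKHM) (i : Fin N) :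
    k.analysis x f i = k.eval (x i) f := rfl

lemma inner_synthesis (k : PDKernel X A) {N : ℕ} (x : Fin N → X) (c : Fin N → A) (f : k.RKHM) :
    k.inner (k.synthesis x c) f = ∑ i, star (c i) * k.eval (x i) f := by
  rw [← star_inner, ← innerHom_apply, synthesis_apply, map_sum, star_sum]
  simp [star_inner, inner_featureMul]

lemma inner_synthesis_right (k : PDKernel X A) {N : ℕ} (x : Fin N → X) (c : Fin N → A)
    (f : k.RKHM) : k.inner f (k.synthesis x c) = ∑ i, star (k.eval (x i) f) * c i := by
  rw [← star_inner, inner_synthesis]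
  simp

/-! ### Order bounds for the evaluations. -/

/-- The `A`-valued boundedness of the evaluation at a point. -/
lemma smul_star_eval_mul_eval_le (k : PDKernel X A) (x : X) {t : ℝ} (ht : 0 ≤ t)
    (htk : t * ‖k.toFun x x‖ ≤ 1) (f : k.RKHM) :
    t • (star (k.eval x f) * k.eval x f) ≤ k.inner f f := by
  set a := k.eval x f with ha
  -- Expanding gives `⟨f, f⟩ - 2t a⋆a + t² a⋆k(x,x)a ≥ 0`; the bound on `t` makes the last term at
  -- most `t a⋆a`.
  have h0 := k.inner_self_nonneg (f + k.featureMul x (-((t : ℂ) • a)))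
  have hfe : k.eval x (k.featureMul x (-((t : ℂ) • a))) = -(t • (k.toFun x x * a)) := by
    simp [featureMul, eval_coe, mul_smul_comm]
  have hr : k.inner f (k.featureMul x (-((t : ℂ) • a))) = -(t • (star a * a)) := by
    rw [← star_inner, inner_featureMul]; simp [← ha, mul_smul_comm]
  rw [inner_add_right, inner_add_left, inner_add_left, hr, inner_featureMul, inner_featureMul,
    hfe, ← ha] at h0
  have hk : star a * k.toFun x x * a ≤ ‖k.toFun x x‖ • (star a * a) :=
    CStarAlgebra.star_left_conjugate_le_norm_smul
      (hb := by rw [IsSelfAdjoint, ← k.star_symm])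
  have h1 : t • t • (star a * k.toFun x x * a) ≤ t • (star a * a) :=
    smul_le_smul_of_nonneg_left (by
      calc t • (star a * k.toFun x x * a) ≤ t • ‖k.toFun x x‖ • (star a * a) := by gcongr
        _ ≤ (1 : ℝ) • (star a * a) := by
          rw [smul_smul]; gcongr; exact star_mul_self_nonneg a
        _ = _ := one_smul _ _) ht
  rw [← sub_nonneg] at h1 ⊢
  convert add_nonneg h0 h1 using 1
  simp [mul_assoc, mul_smul_comm, smul_mul_assoc]
  abel

/-- Averaging the pointwise bounds yields `τ T⋆T ≤ 1` as a form. The `1 +` in `K` and the `N + 1`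
keep the inverses legitimate when the kernel vanishes at the points or `N = 0`. -/
lemma exists_pos_smul_sum_le (k : PDKernel X A) {N : ℕ} (x : Fin N → X) :
    ∃ τ : ℝ, 0 < τ ∧ ∀ f : k.RKHM,
      τ • ∑ i, star (k.eval (x i) f) * k.eval (x i) f ≤ k.inner f f := by
  set K : ℝ := 1 + ∑ i, ‖k.toFun (x i) (x i)‖ with hK
  have hKpos : 0 < K := by positivity
  refine ⟨(N + 1 : ℝ)⁻¹ * K⁻¹, by positivity, fun f => ?_⟩
  have hi : ∀ i, K⁻¹ • (star (k.eval (x i) f) * k.eval (x i) f) ≤ k.inner f f := fun i => by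
    refine k.smul_star_eval_mul_eval_le (x i) (by positivity) ?_ f
    rw [inv_mul_le_one₀ hKpos, hK]
    have := Finset.single_le_sum (f := fun i => ‖k.toFun (x i) (x i)‖)
      (fun _ _ => norm_nonneg _) (Finset.mem_univ i)
    linarith
  have hp := k.inner_self_nonneg f
  calc _ = (N + 1 : ℝ)⁻¹ • ∑ i, K⁻¹ • (star (k.eval (x i) f) * k.eval (x i) f) := by
        rw [mul_smul, Finset.smul_sum]
    _ ≤ (N + 1 : ℝ)⁻¹ • ∑ _i : Fin N, k.inner f f := by
        gcongr with i; exact hi i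
    _ ≤ (N + 1 : ℝ)⁻¹ • ((N + 1 : ℝ) • k.inner f f) := by
        gcongr
        rw [Finset.sum_const, Finset.card_univ, Fintype.card_fin, add_smul, one_smul,
          Nat.cast_smul_eq_nsmul]
        exact le_add_of_nonneg_right hp
    _ = _ := by rw [smul_smul, inv_mul_cancel₀ (by positivity), one_smul]

/-! ### The Landweber iteration. -/

/-- The step `1 - τ T⋆T` of the Landweber iteration, where `T` evaluates at the points `x i`. -/
noncomputable def landweber (k : PDKernel X A) {N : ℕ} (x : Fin N → X) (τ : ℝ) : k.RKHM →ₗ[ℂ] k.RKHM :=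
  LinearMap.id - (τ : ℂ) • (k.synthesis x).comp (k.analysis x).toLinearMap

lemma landweber_apply (k : PDKernel X A) {N : ℕ} (x : Fin N → X) (τ : ℝ) (f : k.RKHM) :
    k.landweber x τ f = f - (τ : ℂ) • k.synthesis x (k.analysis x f) := rfl

lemma inner_landweber_right (k : PDKernel X A) {N : ℕ} (x : Fin N → X) (τ : ℝ) (f g : k.RKHM) :
    k.inner f (k.landweber x τ g) =
      k.inner f g - τ • ∑ i, star (k.eval (x i) f) * k.eval (x i) g := by
  rw [landweber_apply, ← innerHom_apply, map_sub, innerHom_apply, innerHom_apply,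
    inner_smul_right, inner_synthesis_right]
  simp

lemma inner_landweber_left (k : PDKernel X A) {N : ℕ} (x : Fin N → X) (τ : ℝ) (f g : k.RKHM) :
    k.inner (k.landweber x τ f) g = k.inner f (k.landweber x τ g) := by
  rw [← star_inner, inner_landweber_right, inner_landweber_right]
  simp [star_inner]

/-- Each step subtracts `τ T⋆T B^n f`, which is in the range of `T⋆`, so the corrections accumulate
there. -/
lemma exists_synthesis_eq_sub_iterate (k : PDKernel X A) {N : ℕ} (x : Fin N → X) (τ : ℝ)
    (f : k.RKHM) (n : ℕ) : ∃ c, k.synthesis x c = f - (k.landweber x τ)^[n] f := by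
  induction n with
  | zero => exact ⟨0, by simp⟩
  | succ n ih =>
    obtain ⟨c, hc⟩ := ih
    refine ⟨c + (τ : ℂ) • k.analysis x ((k.landweber x τ)^[n] f), ?_⟩
    rw [map_add, map_smul, hc, Function.iterate_succ_apply', landweber_apply]
    abel

open Filter Topology in
/-- Every element of the module has approximants in the span of the `φ(x i)` that are dominated by
it in the `A`-valued sense and whose values at the points `x i` converge to its values. -/
lemma exists_seq_synthesis (k : PDKernel X A) {N : ℕ} (x : Fin N → X) (f : k.RKHM) :
    ∃ c : ℕ → Fin N → A,
      (∀ n, k.inner (k.synthesis x (c n)) (k.synthesis x (c n)) ≤ k.inner f f) ∧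
      Tendsto (fun n => k.analysis x (k.synthesis x (c n))) atTop (𝓝 (k.analysis x f)) := by
  obtain ⟨τ, hτ, hle⟩ := k.exists_pos_smul_sum_le x
  set B : k.RKHM →+ k.RKHM := (k.landweber x τ).toAddMonoidHom with hBdef
  have hBcoe : ⇑(k.landweber x τ) = ⇑B := rfl
  have hadj : ∀ f g, k.innerHom (B f) g = k.innerHom f (B g) := k.inner_landweber_left x τ
  have hpos : ∀ f, 0 ≤ k.innerHom f f := k.inner_self_nonneg
  have hB : ∀ f, 0 ≤ k.innerHom f (B f) := fun f => by
    change 0 ≤ k.inner f (k.landweber x τ f)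
    rw [inner_landweber_right]
    exact sub_nonneg.2 (hle f)
  have hB' : ∀ f, k.innerHom f (B f) ≤ k.innerHom f f := fun f => by
    change k.inner f (k.landweber x τ f) ≤ k.inner f f
    rw [inner_landweber_right]
    exact sub_le_self _
      (smul_nonneg hτ.le (Finset.sum_nonneg fun _ _ => star_mul_self_nonneg _))
  choose c hc using k.exists_synthesis_eq_sub_iterate x τ f
  refine ⟨c, fun n => ?_, ?_⟩
  · rw [hc]
    exact form_sub_iterate_le k.innerHom B hadj hpos hB hB' f n
  suffices hs : ∀ i, Tendsto (fun n => k.eval (x i) (B^[n] f)) atTop (𝓝 0) by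
    rw [tendsto_pi_nhds]
    intro i
    simpa [hc, hBcoe] using (hs i).const_sub (k.eval (x i) f)
  intro i
  have hbound : ∀ n : ℕ, 0 < n → ‖k.eval (x i) (B^[n] f)‖ ^ 2 ≤
      τ⁻¹ * ‖k.inner f f‖ * (n : ℝ)⁻¹ := by
    intro n hn
    set a := fun i => k.eval (x i) (B^[n] f) with ha
    -- By symmetry the left side is `⟨u, (1 - B) u⟩` with `u = B^n f`, and `1 - B = τ T⋆T`.
    have h1 : k.innerHom f (B^[2 * n] f) - k.innerHom f (B^[2 * n + 1] f) =
        τ • ∑ i, star (a i) * a i := by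
      rw [show 2 * n = n + n by omega, show n + n + 1 = n + (n + 1) by omega,
        ← form_iterate_iterate _ B hadj, ← form_iterate_iterate _ B hadj,
        Function.iterate_succ_apply' B, ← hBcoe, innerHom_apply, innerHom_apply,
        inner_landweber_right, hBcoe, sub_sub_cancel]
    have h2 := nsmul_form_diff_le k.innerHom B hadj hpos hB f (2 * n)
    rw [h1, innerHom_apply] at h2
    -- One summand is kept, and the factor `2n` is weakened to `n`.
    have h3 : (n * τ) • (star (a i) * a i) ≤ k.inner f f := by
      refine le_trans ?_ h2
      rw [← Nat.cast_smul_eq_nsmul ℝ, smul_smul]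
      calc (n * τ) • (star (a i) * a i) ≤ (n * τ) • ∑ i, star (a i) * a i := by
            refine smul_le_smul_of_nonneg_left ?_ (by positivity)
            exact Finset.single_le_sum (f := fun i => star (a i) * a i)
              (fun _ _ => star_mul_self_nonneg _) (Finset.mem_univ i)
        _ ≤ _ := by
            refine smul_le_smul_of_nonneg_right ?_
              (Finset.sum_nonneg fun _ _ => star_mul_self_nonneg _)
            push_cast
            nlinarith [show 0 ≤ n * τ by positivity]
    have h4 := CStarAlgebra.norm_le_norm_of_nonneg_of_le
      (smul_nonneg (by positivity) (star_mul_self_nonneg _)) h3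
    rw [norm_smul, Real.norm_of_nonneg (by positivity), CStarRing.norm_star_mul_self] at h4
    have hn' : (0 : ℝ) < n := by exact_mod_cast hn
    rw [← div_eq_mul_inv, inv_mul_eq_div, div_div, le_div_iff₀ (by positivity)]
    linarith
  have hlim : Tendsto (fun n : ℕ => √(τ⁻¹ * ‖k.inner f f‖ * (n : ℝ)⁻¹)) atTop (𝓝 0) := by
    simpa using ((tendsto_inv_atTop_nhds_zero_nat (𝕜 := ℝ)).const_mul
      (τ⁻¹ * ‖k.inner f f‖)).sqrt
  refine squeeze_zero_norm' ?_ hlim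
  filter_upwards [eventually_gt_atTop 0] with n hn
  exact Real.le_sqrt_of_sq_le (hbound n hn)

end PDKernel

/-! ### Approximating the minimizer. -/

open Filter Topology in
theorem mainTheorem5 {X A : Type*} [NonUnitalCStarAlgebra A] [PartialOrder A] [StarOrderedRing A]
    (k : PDKernel X A) {N : ℕ} (x : Fin N → X)
    (g : (Fin N → A) → {a : A // 0 ≤ a}) (hg : Continuous g)
    (h : {a : A // 0 ≤ a} → {a : A // 0 ≤ a}) (hh : ∀ c d, c ≤ d → h c ≤ h d)
    (f₀ : k.RKHM) (hf₀ : ∀ f : k.RKHM, k.loss x g h f₀ ≤ k.loss x g h f)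
    (ε : ℝ) (hε : 0 < ε) :
    ∃ c : Fin N → A,
      ‖k.loss x g h (∑ i, k.featureMul (x i) (c i)) - k.loss x g h f₀‖ ≤ ε := by
  obtain ⟨c, hle, hlim⟩ := k.exists_seq_synthesis x f₀
  have hlim' : Tendsto (fun n => (g (k.analysis x (k.synthesis x (c n))) : A)) atTop
      (𝓝 (g (k.analysis x f₀))) :=
    ((continuous_subtype_val.comp hg).tendsto _).comp hlim
  obtain ⟨n, hn⟩ := (hlim'.eventually (Metric.closedBall_mem_nhds _ hε)).exists
  refine ⟨c n, le_trans ?_ (mem_closedBall_iff_norm.1 hn)⟩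
  rw [← PDKernel.synthesis_apply]
  -- Minimality makes the difference of losses positive, so an upper bound in the order of `A`
  -- suffices for the norm.
  refine CStarAlgebra.norm_le_norm_of_nonneg_of_le (sub_nonneg.2 (hf₀ _)) ?_
  -- The square root is operator monotone.
  have habs : k.absVal (k.synthesis x (c n)) ≤ k.absVal f₀ := CFC.sqrt_le_sqrt _ _ (hle n)
  have hmono : (h (k.absVal (k.synthesis x (c n))) : A) ≤ h (k.absVal f₀) := hh _ _ habs
  rw [← sub_nonneg] at hmono ⊢
  convert hmono using 1
  change _ - _ - ((g (k.analysis x (k.synthesis x (c n))) + _ : A) -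
    (g (k.analysis x f₀) + _)) = _
  abel
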